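/- Let $F$ be the distribution function of a real random variable, with quantile function $Q(s)=\inf\{x:F(x)\ge s\}$, $s\in(0,1)$, and assume that $Q(1-s)=s^{-\gamma}\ell(s)$ for $s\in(0,1)$, where $\gamma>0$ and $\ell$ is slowly varying at $0$. Let $U$ be uniform on $(0,1)$ and, for $p>0$ and $v\in(0,1)$ small, put $$m_p(v)=\mathbb E\left[\left(\log\frac{Q(1-Uv)}{Q(1-v)}\right)^p\right],\qquad m_p=\mathbb E\left[(-\gamma\log U)^p\right]=\gamma^p\,\Gamma(p+1).$$ Assume that there are a function $a$, regularly varying at $0$ (in particular positive near $0$), and a Borel set $B\subset[0,1]$ of positive Lebesgue measure such that $$\lim_{v\downarrow0}\frac{a(v)}{\ell(v)}=0,\qquad \limsup_{v\downarrow0}\frac{|\ell(uv)-\ell(v)|}{a(v)}<\infty\quad\text{for every }u\in B.$$ Let $p_v>0$ be a function of $v$ such that $$\beta:=\liminf_{v\downarrow0}\frac{-\log\left(a(v)/\ell(v)\right)}{p_v}>0,$$ where $\beta=\infty$ is allowed. Put $h(u)=u-1-\log u$ for $u>0$, $\nu_\beta=\beta^{-1}h(\max\{2,2\beta\})$ for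 $0<\beta<\infty$, and $\nu_\infty=2$. Then $m_{p_v}(v)$ is finite for all sufficiently small $v>0$, and the following hold. (i) If $\nu_\beta>1$, then for every $\varepsilon>0$ there exists $K>0$ such that for all sufficiently small $v>0$ $$|m_{p_v}(v)-m_{p_v}|\le K\,\frac{a(v)}{\ell(v)}\,(\gamma+\varepsilon)^{p_v}\,\Gamma(p_v+1).$$ (ii) If $\nu_\beta\le1$, then for every $\varepsilon>0$ there exists $K>0$ such that for all sufficiently small $v>0$ $$|m_{p_v}(v)-m_{p_v}|\le K\left(\frac{a(v)}{\ell(v)}\right)^{\nu_\beta-\varepsilon}(\gamma+\varepsilon)^{p_v}\,\Gamma(p_v+1).$$ -/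

import Mathlib

open MeasureTheory ProbabilityTheory Filter Topology Set

noncomputable section

namespace ExtremalNorm

/-- `f` is regularly varying at `0` (from the right) with index `ρ`: on some interval `(0, δ)` it is
positive and (Lebesgue) measurable, and `f (c x) / f x → c ^ ρ` as `x ↓ 0` for every `c > 0`. -/
structure RegularlyVaryingAtZero (f : ℝ → ℝ) (ρ : ℝ) : Prop where
  pos_and_measurable : ∃ δ : ℝ, 0 < δ ∧ (∀ x ∈ Ioo (0 : ℝ) δ, 0 < f x) ∧
    AEMeasurable f (volume.restrict (Ioo (0 : ℝ) δ))
  tendsto_ratio : ∀ c : ℝ, 0 < c →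
    Tendsto (fun x : ℝ => f (c * x) / f x) (𝓝[>] (0 : ℝ)) (𝓝 (c ^ ρ))

/-- Slow variation at `0` is regular variation with index `0`. -/
def SlowlyVaryingAtZero (f : ℝ → ℝ) : Prop :=
  RegularlyVaryingAtZero f 0

/-- The quantile function `Q(s) = inf {x : F(x) ≥ s}`, `s ∈ (0, 1)`, of the distribution function
`F` of the law `μ`. -/
def quantile (μ : Measure ℝ) (s : ℝ) : ℝ :=
  sInf {x : ℝ | s ≤ cdf μ x}

/-- The uniform distribution on `(0, 1)`. -/
def uniform01 : Measure ℝ :=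
  volume.restrict (Ioo (0 : ℝ) 1)

/-- The variable `Y(v) = log (Q(1 - U v) / Q(1 - v))`, as a function of the value `u` of `U`. -/
def Y (μ : Measure ℝ) (v u : ℝ) : ℝ :=
  Real.log (quantile μ (1 - u * v) / quantile μ (1 - v))

/-- `m_p(v) = E[Y(v) ^ p]`, where `U` is uniform on `(0, 1)`. -/
def moment (μ : Measure ℝ) (p v : ℝ) : ℝ :=
  ∫ u, Y μ v u ^ p ∂uniform01

/-- `m_p = E[(-γ log U) ^ p]`, where `U` is uniform on `(0, 1)`. -/
def limitMoment (γ p : ℝ) : ℝ :=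
  ∫ u, (-γ * Real.log u) ^ p ∂uniform01

/-- `h(u) = u - 1 - log u`, `u > 0`. -/
def h (u : ℝ) : ℝ :=
  u - 1 - Real.log u

open Classical in
/-- `ν_β = β⁻¹ h(max 2 (2 β))` for `β ∈ (0, ∞)`, and `ν_∞ = 2`. -/
def nu (β : EReal) : ℝ :=
  if β = ⊤ then 2 else β.toReal⁻¹ * h (max 2 (2 * β.toReal))

end ExtremalNorm

end

/-! Write v = exp(-x), f(x) = l(exp(-x)), g(x) = a(exp(-x)). The hypothesis on B says that f(x + t)
- f(x) = O(g(x)) for t in a set of positive measure. Regular variation gives g(x + t) = O(g(x)), so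
the admissible t form an additive group. By Steinhaus it contains a neighbourhood of 0, hence is all
of ℝ (`incrementBounded_of_volume_pos`). As in the uniform convergence theorem, the bound is then
uniform for t in [0, 1] (`exists_uniform_increment_bound`). Since a/l → 0 with l slowly varying, a
has index ρ ≥ 0, so g grows more slowly than any exponential. Summing unit steps gives |f(x + t) -
f(x)| ≤ C g(x) exp(δt) for all t ≥ 0 (`exists_abs_sub_le_mul_rpow`).

Put A = a(v)/l(v) and U = exp(-x), with x exponentially distributed. Then Y = γx + log(l(Uv)/l(v)),
which yields both |Y - γx| ≤ D A exp(2δx) and Y ≤ (γ + δ)x + δ (`Y_exp_neg_bounds`). The mean value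
theorem bounds |Y^p - (γx)^p| by p((γ + δ)x + δ)^(p - 1) D A exp(2δx) when p ≥ 1. Its integral
against exp(-x) is a Gamma integral, where p Γ(p) = Γ(p + 1). Orders p ≤ 1 need a separate treatment
near x = 0. The outcome (`exists_moment_bound`) is an error K A (γ + ε)^p Γ(p + 1) with K
independent of p and v. This is (i); (ii) follows because A ≤ A^(ν - ε) when A < 1 and ν ≤ 1. -/

namespace ExtremalNorm

/-! ### Increments dominated by an auxiliary function, in additive form -/

/-- The increment of `f` of step `t` is `O(g)` at infinity. -/
def IncrementBounded (f g : ℝ → ℝ) (t : ℝ) : Prop :=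
  ∃ M : ℝ, ∀ᶠ x in atTop, |f (x + t) - f x| ≤ M * g x

/-- Steps `y ∈ [0, 2]` whose increments of `f` along the sequence `z` are bounded by `n * g` from
the index `n` on. -/
def goodSteps (f g : ℝ → ℝ) (z : ℕ → ℝ) (n : ℕ) : Set ℝ :=
  {y | y ∈ Icc (0 : ℝ) 2 ∧ ∀ k ≥ n, |f (z k + y) - f (z k)| ≤ n * g (z k)}

lemma aemeasurable_comp_const_add {f : ℝ → ℝ} {X c : ℝ}
    (hf : AEMeasurable f (volume.restrict (Ioi X))) (hc : X < c) :
    AEMeasurable (fun y => f (c + y)) (volume.restrict (Icc (0 : ℝ) 2)) := by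
  have h1 : MeasurePreserving (fun y : ℝ => c + y) volume volume := measurePreserving_add_left _ c
  have h2 := h1.restrict_preimage (s := Ioi X) measurableSet_Ioi
  have h3 : AEMeasurable (fun y => f (c + y)) (volume.restrict ((fun y => c + y) ⁻¹' Ioi X)) :=
    hf.comp_quasiMeasurePreserving h2.quasiMeasurePreserving
  refine h3.mono_measure (Measure.restrict_mono ?_ le_rfl)
  intro y hy
  simp only [mem_preimage, mem_Ioi]
  linarith [hy.1]

lemma nullMeasurableSet_goodSteps {f g : ℝ → ℝ} {X : ℝ} {z : ℕ → ℝ}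
    (hf : AEMeasurable f (volume.restrict (Ioi X))) (hz : ∀ k, X < z k) (n : ℕ) :
    NullMeasurableSet (goodSteps f g z n) := by
  have h1 : NullMeasurableSet {y | ∀ k ≥ n, |f (z k + y) - f (z k)| ≤ n * g (z k)}
      (volume.restrict (Icc (0 : ℝ) 2)) := by
    have : {y | ∀ k ≥ n, |f (z k + y) - f (z k)| ≤ n * g (z k)} =
        ⋂ k, ⋂ (_ : k ≥ n), {y | |f (z k + y) - f (z k)| ≤ n * g (z k)} := by
      ext y; simp
    rw [this]
    refine NullMeasurableSet.iInter fun k => NullMeasurableSet.iInter fun _ => ?_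
    have hm := aemeasurable_comp_const_add hf (hz k)
    exact nullMeasurableSet_le ((hm.sub_const _).abs) aemeasurable_const
  have h2 := (nullMeasurableSet_restrict (μ := volume)
    (measurableSet_Icc (a := (0 : ℝ)) (b := 2)).nullMeasurableSet).1 h1
  rwa [inter_comm] at h2

/-- The sets increase with n and exhaust [0, 2], so their measures tend to 2. The threshold 3/2 is
half the length of [0, 3], where two such sets will be made to meet. -/
lemma eventually_lt_volume_goodSteps {f g : ℝ → ℝ} {z : ℕ → ℝ}
    (hg : ∀ k, 0 ≤ g (z k)) (hz : Tendsto z atTop atTop)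
    (hb : ∀ t : ℝ, 0 ≤ t → IncrementBounded f g t) :
    ∀ᶠ n in atTop, ENNReal.ofReal (3 / 2) < volume (goodSteps f g z n) := by
  have hmono : Monotone (goodSteps f g z) := by
    intro m n hmn y hy
    refine ⟨hy.1, fun k hk => (hy.2 k (hmn.trans hk)).trans ?_⟩
    exact mul_le_mul_of_nonneg_right (by exact_mod_cast hmn) (hg k)
  have hunion : ⋃ n, goodSteps f g z n = Icc 0 2 := by
    ext y
    simp only [mem_iUnion]
    refine ⟨fun ⟨n, hn⟩ => hn.1, fun hy => ?_⟩
    obtain ⟨M, hM⟩ := hb y hy.1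
    obtain ⟨N, hN⟩ := eventually_atTop.1 (hz.eventually hM)
    obtain ⟨m, hm⟩ := exists_nat_ge M
    refine ⟨max N m, hy, fun k hk => (hN k (le_of_max_le_left hk)).trans ?_⟩
    refine mul_le_mul_of_nonneg_right (hm.trans ?_) (hg k)
    exact_mod_cast le_max_right _ _
  have ht := tendsto_measure_iUnion_atTop (μ := volume) hmono
  rw [hunion, Real.volume_Icc] at ht
  refine ht.eventually_const_lt ?_
  rw [ENNReal.ofReal_lt_ofReal_iff] <;> norm_num

/-- Pointwise bounded increments are bounded uniformly over steps in `[0, 1]`. -/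
lemma exists_uniform_increment_bound {f g : ℝ → ℝ} {X C : ℝ}
    (hf : AEMeasurable f (volume.restrict (Ioi X))) (hgpos : ∀ x > X, 0 ≤ g x)
    (hg : ∀ x > X, ∀ t ∈ Icc (0 : ℝ) 1, g (x + t) ≤ C * g x)
    (hb : ∀ t : ℝ, 0 ≤ t → IncrementBounded f g t) :
    ∃ M Y : ℝ, ∀ x ≥ Y, ∀ t ∈ Icc (0 : ℝ) 1, |f (x + t) - f x| ≤ M * g x := by
  -- Otherwise there are x_k → ∞ and t_k in [0, 1] with |f(x_k + t_k) - f(x_k)| > k g(x_k). A common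
  -- point x_k + y, reached by good steps from both x_k and x_k + t_k, bounds this increment by (n +
  -- nC) g(x_k), with n fixed.
  by_contra! hcon
  choose x hx t ht hxt using fun k : ℕ => hcon k (X + 1 + k)
  have hxX : ∀ k, X < x k := fun k => by
    have := hx k
    have : (0 : ℝ) ≤ k := k.cast_nonneg
    linarith
  have hx_top : Tendsto x atTop atTop :=
    tendsto_atTop_mono hx (tendsto_atTop_add_const_left _ _ tendsto_natCast_atTop_atTop)
  have hxtX : ∀ k, X < x k + t k := fun k => by linarith [hxX k, (ht k).1]
  have hxt_top : Tendsto (fun k => x k + t k) atTop atTop :=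
    tendsto_atTop_mono (fun k => by linarith [(ht k).1]) hx_top
  obtain ⟨n, hn1, hn2⟩ := ((eventually_lt_volume_goodSteps (fun k => hgpos _ (hxX k)) hx_top hb).and
    (eventually_lt_volume_goodSteps (fun k => hgpos _ (hxtX k)) hxt_top hb)).exists
  obtain ⟨k0, hk0⟩ := exists_nat_ge (n + n * C : ℝ)
  set k := max n k0 with hk
  have hkn : k ≥ n := le_max_left _ _
  have hkC : (n + n * C : ℝ) ≤ k := hk0.trans (by exact_mod_cast le_max_right _ _)
  set V := goodSteps f g x n with hV
  set W := (fun y => y + -t k) ⁻¹' goodSteps f g (fun k => x k + t k) n with hW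
  have hWvol : volume W = volume (goodSteps f g (fun k => x k + t k) n) :=
    measure_preimage_add_right _ _ _
  have hVsub : V ⊆ Icc 0 3 := fun y hy => ⟨hy.1.1, by linarith [hy.1.2]⟩
  have hWsub : W ⊆ Icc 0 3 := fun y hy => by
    have h1 := hy.1
    have := ht k
    simp only [mem_Icc] at h1 this ⊢
    constructor <;> linarith
  -- Two subsets of [0, 3], each of measure more than 3/2, must meet.
  have hinter : (V ∩ W).Nonempty := by
    by_contra hne
    rw [not_nonempty_iff_eq_empty] at hne
    have hdis : AEDisjoint volume W V := by
      rw [AEDisjoint, inter_comm, hne, measure_empty]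
    have h1 := measure_union₀ (nullMeasurableSet_goodSteps (g := g) hf hxX n) hdis
    have h2 : volume (W ∪ V) ≤ ENNReal.ofReal 3 := by
      refine (measure_mono (union_subset hWsub hVsub)).trans ?_
      rw [Real.volume_Icc]; norm_num
    have h3 : ENNReal.ofReal 3 < volume W + volume V := by
      have : ENNReal.ofReal 3 = ENNReal.ofReal (3 / 2) + ENNReal.ofReal (3 / 2) := by
        rw [← ENNReal.ofReal_add] <;> norm_num
      rw [this, hWvol]
      exact ENNReal.add_lt_add hn2 hn1
    rw [← h1] at h3
    exact absurd h3 (not_lt.2 h2)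
  obtain ⟨y, hyV, hyW⟩ := hinter
  have e1 := hyV.2 k hkn
  have e2 := hyW.2 k hkn
  have e3 := hxt k
  have e4 := hg _ (hxX k) _ (ht k)
  have e5 : x k + t k + (y + -t k) = x k + y := by ring
  simp only [e5] at e2
  have e6 : |f (x k + t k) - f (x k)| ≤ |f (x k + y) - f (x k)| + |f (x k + y) - f (x k + t k)| := by
    have := abs_sub_le (f (x k + t k)) (f (x k + y)) (f (x k))
    rw [abs_sub_comm (f (x k + t k)) (f (x k + y))] at this
    linarith
  have e7 : (n : ℝ) * g (x k + t k) ≤ n * (C * g (x k)) :=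
    mul_le_mul_of_nonneg_left e4 n.cast_nonneg
  have e8 : (n + n * C : ℝ) * g (x k) ≤ k * g (x k) :=
    mul_le_mul_of_nonneg_right hkC (hgpos _ (hxX k))
  nlinarith

/-- If the increments are bounded for a set of steps of positive measure, they are bounded for
every step. -/
lemma incrementBounded_of_volume_pos {f g : ℝ → ℝ} (hgpos : ∀ᶠ x in atTop, 0 ≤ g x)
    (hg : ∀ t : ℝ, ∃ C : ℝ, ∀ᶠ x in atTop, g (x + t) ≤ C * g x) {T : Set ℝ}
    (hT : MeasurableSet T) (hTpos : 0 < volume T) (hb : ∀ t ∈ T, IncrementBounded f g t) (t : ℝ) :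
    IncrementBounded f g t := by
  have hshift : ∀ s : ℝ, Tendsto (fun x : ℝ => x + s) atTop atTop := fun s =>
    tendsto_atTop_add_const_right _ _ tendsto_id
  have hcomp : ∀ (M s : ℝ), ∃ M' : ℝ, ∀ᶠ x in atTop, M * g (x + s) ≤ M' * g x := by
    intro M s
    obtain ⟨C, hC⟩ := hg s
    refine ⟨|M| * C, ?_⟩
    filter_upwards [hC, (hshift s).eventually hgpos] with x h1 h2
    calc M * g (x + s) ≤ |M| * g (x + s) := mul_le_mul_of_nonneg_right (le_abs_self M) h2
      _ ≤ |M| * (C * g x) := mul_le_mul_of_nonneg_left h1 (abs_nonneg M)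
      _ = |M| * C * g x := by ring
  let S : AddSubgroup ℝ :=
    { carrier := {t | IncrementBounded f g t}
      zero_mem' := ⟨0, by simp⟩
      add_mem' := by
        rintro s t ⟨M, hM⟩ ⟨N, hN⟩
        obtain ⟨N', hN'⟩ := hcomp N s
        refine ⟨M + N', ?_⟩
        filter_upwards [hM, (hshift s).eventually hN, hN'] with x h1 h2 h3
        have := abs_sub_le (f (x + (s + t))) (f (x + s)) (f x)
        rw [add_assoc] at h2
        linarith
      neg_mem' := by
        rintro t ⟨M, hM⟩
        obtain ⟨N', hN'⟩ := hcomp M (-t)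
        refine ⟨N', ?_⟩
        filter_upwards [(hshift (-t)).eventually hM, hN'] with x h1 h2
        rw [neg_add_cancel_right, abs_sub_comm] at h1
        exact h1.trans h2 }
  -- Steinhaus: T - T is a neighbourhood of 0. An open subgroup is also closed, hence everything by
  -- connectedness.
  have hnhds : (S : Set ℝ) ∈ 𝓝 (0 : ℝ) := by
    refine mem_of_superset (Measure.sub_mem_nhds_zero_of_addHaar_pos volume T hT hTpos) ?_
    rintro _ ⟨s, hs, r, hr, rfl⟩
    exact S.sub_mem (hb s hs) (hb r hr)
  have hopen : IsOpen (S : Set ℝ) := S.isOpen_of_mem_nhds hnhds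
  have huniv : (S : Set ℝ) = univ :=
    IsClopen.eq_univ ⟨AddSubgroup.isClosed_of_isOpen S hopen, hopen⟩ ⟨0, S.zero_mem⟩
  have : t ∈ (S : Set ℝ) := huniv ▸ mem_univ t
  exact this

/-- Global bound on the increments, for an auxiliary function growing slower than every
exponential. -/
lemma exists_global_increment_bound {f g : ℝ → ℝ} {δ M X : ℝ} (hδ : 0 < δ)
    (hgpos : ∀ x ≥ X, 0 ≤ g x) (hg : ∀ x ≥ X, g (x + 1) ≤ Real.exp δ * g x)
    (hf : ∀ x ≥ X, ∀ t ∈ Icc (0 : ℝ) 1, |f (x + t) - f x| ≤ M * g x) :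
    ∃ C : ℝ, 0 < C ∧ ∀ x ≥ X, ∀ t : ℝ, 0 ≤ t →
      |f (x + t) - f x| ≤ C * g x * Real.exp (2 * δ * t) := by
  have key : ∀ n : ℕ, ∀ x ≥ X, ∀ r ∈ Icc (0 : ℝ) 1,
      |f (x + (n + r)) - f x| ≤ |M| * (n + 1) * Real.exp (δ * n) * g x := by
    intro n
    induction n with
    | zero =>
      intro x hx r hr
      have h1 := hf x hx r hr
      have h2 := mul_le_mul_of_nonneg_right (le_abs_self M) (hgpos x hx)
      simpa using h1.trans h2
    | succ n ih =>
      intro x hx r hr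
      have h1 := ih (x + 1) (by linarith) r hr
      have h2 := hf x hx 1 (by simp)
      have h3 : |M| * (n + 1) * Real.exp (δ * n) * g (x + 1) ≤
          |M| * (n + 1) * Real.exp (δ * n) * (Real.exp δ * g x) :=
        mul_le_mul_of_nonneg_left (hg x hx) (by positivity)
      have h4 : M * g x ≤ |M| * Real.exp (δ * (n + 1)) * g x := by
        refine mul_le_mul_of_nonneg_right ?_ (hgpos x hx)
        have : 1 ≤ Real.exp (δ * (n + 1)) := Real.one_le_exp (by positivity)
        nlinarith [le_abs_self M, abs_nonneg M]
      have h5 : Real.exp (δ * (n + 1)) = Real.exp (δ * n) * Real.exp δ := by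
        rw [← Real.exp_add]; ring_nf
      have h6 : x + 1 + (n + r) = x + ((n + 1 : ℕ) + r) := by push_cast; ring
      rw [h6] at h1
      have h7 := abs_sub_le (f (x + ((n + 1 : ℕ) + r))) (f (x + 1)) (f x)
      push_cast at h7 h1 ⊢
      rw [h5] at h4 ⊢
      linarith
  refine ⟨(|M| + 1) * (1 + 1 / δ), by positivity, fun x hx t ht => ?_⟩
  have h1 := key ⌊t⌋₊ x hx (t - ⌊t⌋₊)
    ⟨by linarith [Nat.floor_le ht], by linarith [Nat.lt_floor_add_one t]⟩
  rw [add_sub_cancel] at h1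
  -- The number of unit steps is absorbed by a second factor exp(δt), whence the rate 2δ.
  have h2 : ((⌊t⌋₊ : ℝ) + 1) ≤ (1 + 1 / δ) * Real.exp (δ * t) := by
    have := Real.add_one_le_exp (δ * t)
    have h3 := Nat.floor_le ht
    have h4 : 1 ≤ Real.exp (δ * t) := Real.one_le_exp (by positivity)
    have h5 : t ≤ 1 / δ * Real.exp (δ * t) := by
      rw [one_div, inv_mul_eq_div, le_div_iff₀ hδ]; linarith
    linarith
  have h3 : Real.exp (δ * ⌊t⌋₊) ≤ Real.exp (δ * t) :=
    Real.exp_le_exp.2 (mul_le_mul_of_nonneg_left (Nat.floor_le ht) hδ.le)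
  have h4 : Real.exp (2 * δ * t) = Real.exp (δ * t) * Real.exp (δ * t) := by
    rw [← Real.exp_add]; ring_nf
  calc |f (x + t) - f x| ≤ |M| * (⌊t⌋₊ + 1) * Real.exp (δ * ⌊t⌋₊) * g x := h1
    _ ≤ (|M| + 1) * ((1 + 1 / δ) * Real.exp (δ * t)) * Real.exp (δ * t) * g x := by
      have := hgpos x hx
      gcongr
      linarith
    _ = (|M| + 1) * (1 + 1 / δ) * g x * Real.exp (2 * δ * t) := by rw [h4]; ring

end ExtremalNorm

namespace ExtremalNorm

/-! ### Passing between regular variation at zero and additive arguments at infinity -/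

lemma tendsto_exp_neg_atTop_nhdsGT : Tendsto (fun x : ℝ => Real.exp (-x)) atTop (𝓝[>] 0) :=
  tendsto_nhdsWithin_iff.2 ⟨Real.tendsto_exp_neg_atTop_nhds_zero,
    Eventually.of_forall fun _ => Real.exp_pos _⟩

lemma eventually_nhdsGT_iff_eventually_exp_neg {P : ℝ → Prop} :
    (∀ᶠ v in 𝓝[>] (0 : ℝ), P v) ↔ ∀ᶠ x in atTop, P (Real.exp (-x)) := by
  refine ⟨fun h => tendsto_exp_neg_atTop_nhdsGT.eventually h, fun h => ?_⟩
  have h1 : Tendsto (fun v => -Real.log v) (𝓝[>] 0) atTop :=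
    tendsto_neg_atBot_atTop.comp Real.tendsto_log_nhdsGT_zero
  filter_upwards [h1.eventually h, self_mem_nhdsWithin] with v hv hv0
  rwa [neg_neg, Real.exp_log hv0] at hv

/-- The exceptional null set pulls back to its image under -log, which is differentiable and so
preserves null sets. -/
lemma aemeasurable_comp_exp_neg {f : ℝ → ℝ} {δ X : ℝ}
    (hf : AEMeasurable f (volume.restrict (Ioo 0 δ))) (hX : Real.exp (-X) ≤ δ) :
    AEMeasurable (fun x => f (Real.exp (-x))) (volume.restrict (Ioi X)) := by
  obtain ⟨f', hf', hae⟩ := hf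
  refine ⟨fun x => f' (Real.exp (-x)), hf'.comp (by fun_prop), ?_⟩
  rw [EventuallyEq, ae_restrict_iff' measurableSet_Ioo, ae_iff] at hae
  rw [EventuallyEq, ae_restrict_iff' measurableSet_Ioi, ae_iff]
  set N := {a | ¬(a ∈ Ioo 0 δ → f a = f' a)} with hN
  have hNpos : ∀ a ∈ N, a ∈ Ioo 0 δ := fun a ha => by
    simp only [hN, mem_ofPred_eq, Classical.not_imp] at ha
    exact ha.1
  refine measure_mono_null ?_ (addHaar_image_eq_zero_of_differentiableOn_of_addHaar_eq_zero
    (f := fun a => -Real.log a) volume (s := N) ?_ hae)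
  · intro x hx
    simp only [mem_ofPred_eq, Classical.not_imp] at hx
    refine ⟨Real.exp (-x), ?_, by simp⟩
    simp only [hN, mem_ofPred_eq, Classical.not_imp]
    exact ⟨⟨Real.exp_pos _, (Real.exp_lt_exp.2 (neg_lt_neg hx.1)).trans_le hX⟩, hx.2⟩
  · intro a ha
    exact (Real.differentiableAt_log (hNpos a ha).1.ne').neg.differentiableWithinAt

/-- If the preimage were null, so would be its image under the differentiable map x ↦ exp(-x), which
contains B \ {0}. -/
lemma volume_preimage_exp_neg_pos {B : Set ℝ} (hB : B ⊆ Ici 0) (hpos : 0 < volume B) :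
    0 < volume ((fun x : ℝ => Real.exp (-x)) ⁻¹' B) := by
  rw [pos_iff_ne_zero]
  intro h0
  have h1 := addHaar_image_eq_zero_of_differentiableOn_of_addHaar_eq_zero
    (f := fun x : ℝ => Real.exp (-x)) volume (s := (fun x : ℝ => Real.exp (-x)) ⁻¹' B)
    (by fun_prop) h0
  have h2 : volume (B \ {0}) = 0 := by
    refine measure_mono_null ?_ h1
    intro b hb
    have hb0 : 0 < b := lt_of_le_of_ne (hB hb.1) (Ne.symm hb.2)
    refine ⟨-Real.log b, ?_, ?_⟩
    · simp only [mem_preimage, neg_neg, Real.exp_log hb0]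
      exact hb.1
    · simp [Real.exp_log hb0]
  rw [measure_sdiff_null Real.volume_singleton] at h2
  exact hpos.ne' h2

namespace RegularlyVaryingAtZero

variable {a : ℝ → ℝ} {ρ : ℝ}

lemma eventually_pos (ha : RegularlyVaryingAtZero a ρ) : ∀ᶠ v in 𝓝[>] (0 : ℝ), 0 < a v := by
  obtain ⟨δ, hδ, hpos, -⟩ := ha.pos_and_measurable
  filter_upwards [Ioo_mem_nhdsGT hδ] with v hv using hpos v hv

lemma tendsto_exp_neg (ha : RegularlyVaryingAtZero a ρ) (t : ℝ) :
    Tendsto (fun x => a (Real.exp (-(x + t))) / a (Real.exp (-x))) atTop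
      (𝓝 (Real.exp (-(ρ * t)))) := by
  have h1 := (ha.tendsto_ratio (Real.exp (-t)) (Real.exp_pos _)).comp tendsto_exp_neg_atTop_nhdsGT
  rw [← Real.exp_mul] at h1
  convert h1 using 2 with x
  · simp only [Function.comp, ← Real.exp_add]
    ring_nf
  · ring_nf

lemma exists_forall_pos_aemeasurable (ha : RegularlyVaryingAtZero a ρ) :
    ∃ X : ℝ, (∀ x > X, 0 < a (Real.exp (-x))) ∧
      AEMeasurable (fun x => a (Real.exp (-x))) (volume.restrict (Ioi X)) := by
  obtain ⟨δ, hδ, hpos, hm⟩ := ha.pos_and_measurable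
  have hX : Real.exp (-(-Real.log δ)) = δ := by rw [neg_neg, Real.exp_log hδ]
  refine ⟨-Real.log δ, fun x hx => hpos _ ⟨Real.exp_pos _, ?_⟩, aemeasurable_comp_exp_neg hm hX.le⟩
  rw [← hX]
  exact Real.exp_lt_exp.2 (neg_lt_neg hx)

/-- A regularly varying function is bounded, up to a constant, by its values at nearby points. -/
lemma exists_forall_exp_neg_add_le (ha : RegularlyVaryingAtZero a ρ) :
    ∃ C X : ℝ, ∀ x > X, ∀ t ∈ Icc (0 : ℝ) 1,
      a (Real.exp (-(x + t))) ≤ C * a (Real.exp (-x)) := by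
  obtain ⟨X, hpos, hm⟩ := ha.exists_forall_pos_aemeasurable
  -- The increments of log a converge, so they are bounded; the uniform bound is applied with the
  -- constant function 1 in place of g.
  have hlim : ∀ t : ℝ, IncrementBounded (fun x => Real.log (a (Real.exp (-x)))) (fun _ => 1) t := by
    intro t
    have h1 := ((Real.continuousAt_log (Real.exp_pos (-(ρ * t))).ne').tendsto.comp
      (ha.tendsto_exp_neg t)).abs
    refine ⟨|Real.log (Real.exp (-(ρ * t)))| + 1, ?_⟩
    filter_upwards [h1.eventually_lt_const (lt_add_one _), eventually_gt_atTop X,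
      eventually_gt_atTop (X - t)] with x hx hx1 hx2
    rw [mul_one, ← Real.log_div (hpos _ (by linarith)).ne' (hpos _ hx1).ne']
    exact hx.le
  obtain ⟨M, Y, hMY⟩ := exists_uniform_increment_bound (C := 1)
    (Real.measurable_log.comp_aemeasurable hm)
    (fun _ _ => zero_le_one) (fun _ _ _ _ => by simp) (fun t _ => hlim t)
  refine ⟨Real.exp M, max X Y, fun x hx t ht => ?_⟩
  have hx1 : X < x := (le_max_left _ _).trans_lt hx
  have hx2 : Y < x := (le_max_right _ _).trans_lt hx
  have h1 := (le_abs_self _).trans (hMY x hx2.le t ht)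
  have h2 := hpos _ hx1
  have h3 := hpos (x + t) (by linarith [ht.1])
  have h4 : Real.log (a (Real.exp (-(x + t)))) ≤ M + Real.log (a (Real.exp (-x))) := by
    simp only [Function.comp] at h1
    linarith
  have h5 := Real.exp_le_exp.2 h4
  rwa [Real.exp_add, Real.exp_log h2, Real.exp_log h3] at h5

end RegularlyVaryingAtZero

/-- A regularly varying function which is negligible with respect to a slowly varying one has
nonnegative index. -/
lemma index_nonneg_of_tendsto_div {a l : ℝ → ℝ} {ρ : ℝ} (ha : RegularlyVaryingAtZero a ρ)
    (hl : SlowlyVaryingAtZero l) (hal : Tendsto (fun v => a v / l v) (𝓝[>] (0 : ℝ)) (𝓝 0)) :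
    0 ≤ ρ := by
  by_contra! hρ
  set A : ℝ → ℝ := fun x => a (Real.exp (-x)) / l (Real.exp (-x)) with hA
  have hA0 : Tendsto A atTop (𝓝 0) := hal.comp tendsto_exp_neg_atTop_nhdsGT
  have hpa := eventually_nhdsGT_iff_eventually_exp_neg.1 ha.eventually_pos
  have hpl := eventually_nhdsGT_iff_eventually_exp_neg.1
    (RegularlyVaryingAtZero.eventually_pos hl)
  have hr := (ha.tendsto_exp_neg 1).div (RegularlyVaryingAtZero.tendsto_exp_neg hl 1)
    (Real.exp_pos _).ne'
  -- If ρ < 0, then A(x + 1)/A(x) → exp(-ρ) > 1, so the positive A eventually increases along unit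
  -- steps and cannot tend to 0.
  have hlt : (1 : ℝ) < Real.exp (-(ρ * 1)) / Real.exp (-(0 * 1)) := by
    simp [hρ]
  obtain ⟨X, hX⟩ := eventually_atTop.1 ((hr.eventually_const_lt hlt).and (hpa.and hpl))
  have hpos : ∀ x ≥ X, 0 < A x := fun x hx => div_pos (hX x hx).2.1 (hX x hx).2.2
  have hstep : ∀ x ≥ X, A x ≤ A (x + 1) := by
    intro x hx
    have h1 := (hX x hx).1
    have h2 : a (Real.exp (-(x + 1))) / a (Real.exp (-x)) /
        (l (Real.exp (-(x + 1))) / l (Real.exp (-x))) = A (x + 1) / A x := by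
      have := (hX x hx).2
      have := (hX (x + 1) (by linarith)).2
      simp only [hA]
      field_simp
    simp only [Pi.div_apply, h2] at h1
    exact ((one_lt_div (hpos x hx)).1 h1).le
  have hind : ∀ n : ℕ, A X ≤ A (X + n) := by
    intro n
    induction n with
    | zero => simp
    | succ n ih =>
      refine ih.trans ?_
      have := hstep (X + n) (by linarith [n.cast_nonneg (α := ℝ)])
      push_cast
      rwa [← add_assoc]
  have hlim : Tendsto (fun n : ℕ => A (X + n)) atTop (𝓝 0) :=
    hA0.comp (tendsto_atTop_add_const_left _ _ tendsto_natCast_atTop_atTop)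
  exact absurd (ge_of_tendsto' hlim hind) (not_le.2 (hpos X le_rfl))

/-- Global bound on the increments of `l` in terms of `a`. -/
lemma exists_abs_sub_le_mul_rpow {a l : ℝ → ℝ} {ρ : ℝ} (ha : RegularlyVaryingAtZero a ρ)
    (hl : SlowlyVaryingAtZero l) (hal : Tendsto (fun v => a v / l v) (𝓝[>] (0 : ℝ)) (𝓝 0))
    {B : Set ℝ} (hB : MeasurableSet B) (hB0 : B ⊆ Ici 0) (hBpos : 0 < volume B)
    (hlB : ∀ u ∈ B,
      limsup (fun v : ℝ => ((|l (u * v) - l v| / a v : ℝ) : EReal)) (𝓝[>] (0 : ℝ)) < ⊤)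
    {δ : ℝ} (hδ : 0 < δ) :
    ∃ C : ℝ, 0 < C ∧ ∀ᶠ v in 𝓝[>] (0 : ℝ), ∀ t : ℝ, 0 ≤ t →
      |l (Real.exp (-t) * v) - l v| ≤ C * a v * Real.exp (δ * t) := by
  set f : ℝ → ℝ := fun x => l (Real.exp (-x)) with hf
  set g : ℝ → ℝ := fun x => a (Real.exp (-x)) with hg
  have hρ := index_nonneg_of_tendsto_div ha hl hal
  obtain ⟨X₁, -, hfm⟩ := RegularlyVaryingAtZero.exists_forall_pos_aemeasurable hl
  obtain ⟨X₂, hgpos, -⟩ := ha.exists_forall_pos_aemeasurable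
  obtain ⟨C₁, X₃, hC₁⟩ := ha.exists_forall_exp_neg_add_le
  have hT : ∀ t ∈ (fun x : ℝ => Real.exp (-x)) ⁻¹' B, IncrementBounded f g t := by
    intro t ht
    obtain ⟨M, hM1, -⟩ := EReal.exists_between_coe_real (hlB _ ht)
    have h1 := eventually_nhdsGT_iff_eventually_exp_neg.1 (eventually_lt_of_limsup_lt hM1)
    refine ⟨M, ?_⟩
    filter_upwards [h1, eventually_gt_atTop X₂] with x hx1 hx2
    have h2 : |l (Real.exp (-t) * Real.exp (-x)) - l (Real.exp (-x))| / a (Real.exp (-x)) < M := by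
      exact_mod_cast hx1
    rw [div_lt_iff₀ (hgpos x hx2), ← Real.exp_add] at h2
    have h3 : -(x + t) = -t + -x := by ring
    simp only [hf, hg, h3]
    exact h2.le
  have hall := incrementBounded_of_volume_pos (f := f) (g := g)
    ((eventually_gt_atTop X₂).mono fun x hx => (hgpos x hx).le) (fun t => by
      refine ⟨Real.exp (-(ρ * t)) + 1, ?_⟩
      filter_upwards [(ha.tendsto_exp_neg t).eventually_lt_const (lt_add_one _),
        eventually_gt_atTop X₂] with x hx1 hx2
      exact ((div_lt_iff₀ (hgpos x hx2)).1 hx1).le)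
    (hB.preimage (by fun_prop)) (volume_preimage_exp_neg_pos hB0 hBpos) hT
  obtain ⟨M, Y, hMY⟩ := exists_uniform_increment_bound (f := f) (g := g) (X := max X₁ (max X₂ X₃))
    (hfm.mono_measure (Measure.restrict_mono (Ioi_subset_Ioi (le_max_left _ _)) le_rfl))
    (fun x hx => (hgpos x (by simp at hx; exact hx.2.1)).le)
    (fun x hx => hC₁ x (by simp at hx; exact hx.2.2)) (fun t _ => hall t)
  -- The ratio tends to exp(-ρ) ≤ 1. The rate is δ/2 because summing the steps doubles it.
  have hstep : ∀ᶠ x in atTop, g (x + 1) ≤ Real.exp (δ / 2) * g x := by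
    have hlt : Real.exp (-(ρ * 1)) < Real.exp (δ / 2) := Real.exp_lt_exp.2 (by linarith)
    filter_upwards [(ha.tendsto_exp_neg 1).eventually_lt_const hlt,
        eventually_gt_atTop X₂] with x hx1 hx2
    exact ((div_lt_iff₀ (hgpos x hx2)).1 hx1).le
  obtain ⟨Z, hZ⟩ := eventually_atTop.1 hstep
  obtain ⟨C, hC, hCb⟩ := exists_global_increment_bound (f := f) (g := g) (δ := δ / 2) (M := M)
    (X := max Y (max (X₂ + 1) Z)) (by positivity)
    (fun x hx => (hgpos x (by simp at hx; linarith [hx.2.1])).le)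
    (fun x hx => hZ x (by simp at hx; exact hx.2.2))
    (fun x hx => hMY x (by simp at hx; exact hx.1))
  refine ⟨C, hC, eventually_nhdsGT_iff_eventually_exp_neg.2 ?_⟩
  filter_upwards [eventually_ge_atTop (max Y (max (X₂ + 1) Z))] with x hx t ht
  have h1 := hCb x hx t ht
  have h3 : -(x + t) = -t + -x := by ring
  have h4 : 2 * (δ / 2) * t = δ * t := by ring
  simp only [hf, hg, h3, h4, Real.exp_add] at h1
  exact h1

end ExtremalNorm

namespace ExtremalNorm

/-! ### Differences of powers -/

lemma abs_rpow_sub_rpow_le_of_one_le {p y b m : ℝ} (hp : 1 ≤ p) (hy : 0 ≤ y) (hb : 0 ≤ b)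
    (hym : y ≤ m) (hbm : b ≤ m) : |y ^ p - b ^ p| ≤ p * m ^ (p - 1) * |y - b| := by
  have h := Convex.norm_image_sub_le_of_norm_hasDerivWithin_le (f := fun x : ℝ => x ^ p)
    (f' := fun x => p * x ^ (p - 1)) (s := Icc 0 m) (C := p * m ^ (p - 1)) (x := b) (y := y)
    (fun x _ => (Real.hasDerivAt_rpow_const (Or.inr hp)).hasDerivWithinAt) (fun x hx => by
      rw [Real.norm_of_nonneg (mul_nonneg (by linarith) (Real.rpow_nonneg hx.1 _))]
      exact mul_le_mul_of_nonneg_left (Real.rpow_le_rpow hx.1 hx.2 (by linarith)) (by linarith))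
    (convex_Icc 0 m) ⟨hb, hbm⟩ ⟨hy, hym⟩
  simpa [Real.norm_eq_abs] using h

/-- Bernoulli's inequality applied to the larger over the smaller of y and b. If b/2 < y < b,
replacing 1/y by 2/b costs the factor 2; if y ≤ b/2, only the trivial bound b^p remains, which is
the second term. -/
lemma abs_rpow_sub_rpow_le_of_le_one {p y b : ℝ} (hp0 : 0 < p) (hp : p ≤ 1) (hy : 0 ≤ y)
    (hb : 0 < b) : |y ^ p - b ^ p| ≤
      2 * p * |y - b| * b ^ (p - 1) + if b ≤ 2 * |y - b| then b ^ p else 0 := by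
  have hbp : 0 < b ^ p := Real.rpow_pos_of_pos hb p
  have hyp : 0 ≤ y ^ p := Real.rpow_nonneg hy p
  have hb1 : b ^ (p - 1) = b ^ p / b := by rw [Real.rpow_sub_one hb.ne']
  have hite : 0 ≤ (if b ≤ 2 * |y - b| then b ^ p else 0) := by split_ifs <;> positivity
  rcases le_or_gt b y with hby | hby
  · have hle : b ^ p ≤ y ^ p := Real.rpow_le_rpow hb.le hby hp0.le
    have h1 := rpow_one_add_le_one_add_mul_self (s := (y - b) / b) (p := p)
      (by linarith [div_nonneg (sub_nonneg.2 hby) hb.le]) hp0.le hp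
    have h2 : 1 + (y - b) / b = y / b := by field_simp; ring
    rw [h2, Real.div_rpow hy hb.le, div_le_iff₀ hbp] at h1
    rw [abs_of_nonneg (sub_nonneg.2 hle), abs_of_nonneg (sub_nonneg.2 hby)] at *
    rw [hb1]
    have h3 : (1 + p * ((y - b) / b)) * b ^ p = b ^ p + p * (y - b) * (b ^ p / b) := by
      field_simp
    have h4 : 0 ≤ p * (y - b) * (b ^ p / b) :=
      mul_nonneg (mul_nonneg hp0.le (sub_nonneg.2 hby)) (by positivity)
    linarith
  · have hle : y ^ p ≤ b ^ p := Real.rpow_le_rpow hy hby.le hp0.le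
    rw [abs_of_nonpos (sub_nonpos.2 hle), abs_of_nonpos (sub_nonpos.2 hby.le)] at *
    rcases le_or_gt b (2 * -(y - b)) with h | h
    · rw [if_pos h, hb1]
      have h4 : 0 ≤ 2 * p * -(y - b) * (b ^ p / b) :=
        mul_nonneg (mul_nonneg (by linarith) (by linarith)) (by positivity)
      linarith
    · rw [if_neg (not_le.2 h), hb1]
      have hy0 : 0 < y := by linarith
      have h1 := rpow_one_add_le_one_add_mul_self (s := (b - y) / y) (p := p)
        (by linarith [div_nonneg (sub_nonneg.2 hby.le) hy]) hp0.le hp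
      have h2 : 1 + (b - y) / y = b / y := by field_simp; ring
      have hyp' : 0 < y ^ p := Real.rpow_pos_of_pos hy0 p
      rw [h2, Real.div_rpow hb.le hy, div_le_iff₀ hyp'] at h1
      have h3 : (b - y) / y ≤ (b - y) * 2 / b := by
        rw [div_le_div_iff₀ hy0 hb]
        nlinarith
      have h5 : p * ((b - y) / y) * y ^ p ≤ p * ((b - y) * 2 / b) * b ^ p := by
        have : 0 ≤ (b - y) / y := div_nonneg (by linarith) hy
        gcongr
      have h6 : p * ((b - y) * 2 / b) * b ^ p = 2 * p * -(y - b) * (b ^ p / b) := by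
        field_simp; ring
      linarith

/-! ### The logarithm of a uniform variable -/

lemma image_exp_neg_Ioi : (fun x : ℝ => Real.exp (-x)) '' Ioi 0 = Ioo 0 1 := by
  ext u
  constructor
  · rintro ⟨x, hx, rfl⟩
    exact ⟨Real.exp_pos _, by simpa using hx⟩
  · intro hu
    exact ⟨-Real.log u, neg_pos.2 (Real.log_neg hu.1 hu.2), by simp [Real.exp_log hu.1]⟩

lemma integrable_uniform01_iff (F : ℝ → ℝ) : Integrable F uniform01 ↔
    IntegrableOn (fun x => Real.exp (-x) * F (Real.exp (-x))) (Ioi 0) := by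
  have h := integrableOn_image_iff_integrableOn_abs_deriv_smul (s := Ioi (0 : ℝ))
    (f := fun x => Real.exp (-x)) (f' := fun x => -Real.exp (-x)) measurableSet_Ioi
    (fun x _ => by simpa using ((hasDerivAt_neg x).exp).hasDerivWithinAt)
    (fun x _ y _ hxy => by simpa using hxy) F
  rw [image_exp_neg_Ioi] at h
  simpa [abs_of_pos (Real.exp_pos _), uniform01, IntegrableOn] using h

lemma integral_uniform01 (F : ℝ → ℝ) :
    ∫ u, F u ∂uniform01 = ∫ x in Ioi 0, Real.exp (-x) * F (Real.exp (-x)) := by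
  have h := integral_image_eq_integral_abs_deriv_smul (s := Ioi (0 : ℝ))
    (f := fun x => Real.exp (-x)) (f' := fun x => -Real.exp (-x)) measurableSet_Ioi
    (fun x _ => by simpa using ((hasDerivAt_neg x).exp).hasDerivWithinAt)
    (fun x _ y _ hxy => by simpa using hxy) F
  rw [image_exp_neg_Ioi] at h
  simpa [abs_of_pos (Real.exp_pos _), uniform01] using h

lemma integrableOn_rpow_mul_exp_neg_mul {s r : ℝ} (hs : -1 < s) (hr : 0 < r) :
    IntegrableOn (fun x : ℝ => x ^ s * Real.exp (-(r * x))) (Ioi 0) := by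
  simpa using integrableOn_rpow_mul_exp_neg_mul_rpow hs zero_lt_one hr

/-- Moments of a perturbation of an exponential variable: comparison through a majorant. -/
lemma integrable_and_abs_sub_limitMoment_le {γ p : ℝ} (hγ : 0 ≤ γ) (hp : 0 < p) {y Ψ : ℝ → ℝ}
    (hy : AEStronglyMeasurable (fun u => y u ^ p) uniform01)
    (hΨ : IntegrableOn (fun x => Real.exp (-x) * Ψ x) (Ioi 0))
    (hle : ∀ x > 0, |y (Real.exp (-x)) ^ p - (γ * x) ^ p| ≤ Ψ x) :
    Integrable (fun u => y u ^ p) uniform01 ∧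
      |∫ u, y u ^ p ∂uniform01 - limitMoment γ p| ≤ ∫ x in Ioi 0, Real.exp (-x) * Ψ x := by
  have hint0 : Integrable (fun u => (-γ * Real.log u) ^ p) uniform01 := by
    rw [integrable_uniform01_iff]
    have h0 : IntegrableOn (fun x : ℝ => γ ^ p * (x ^ p * Real.exp (-(1 * x)))) (Ioi 0) :=
      (integrableOn_rpow_mul_exp_neg_mul (by linarith) one_pos).const_mul _
    refine h0.congr_fun (fun x hx => ?_) measurableSet_Ioi
    have hx0 : (0 : ℝ) ≤ x := le_of_lt hx
    simp only [Real.log_exp, neg_mul_neg, one_mul]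
    rw [Real.mul_rpow hγ hx0]
    ring
  have hΨ' : Integrable (fun u => Ψ (-Real.log u)) uniform01 := by
    rw [integrable_uniform01_iff]
    simpa using hΨ
  have hbound : ∀ᵐ u ∂uniform01, ‖y u ^ p - (-γ * Real.log u) ^ p‖ ≤ Ψ (-Real.log u) := by
    rw [uniform01, ae_restrict_iff' measurableSet_Ioo]
    refine Eventually.of_forall fun u hu => ?_
    have := hle (-Real.log u) (neg_pos.2 (Real.log_neg hu.1 hu.2))
    simpa [Real.exp_log hu.1] using this
  have hint1 : Integrable (fun u => y u ^ p - (-γ * Real.log u) ^ p) uniform01 :=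
    hΨ'.mono' (hy.sub hint0.aestronglyMeasurable) hbound
  have hint : Integrable (fun u => y u ^ p) uniform01 := by
    refine (hint1.add hint0).congr (Eventually.of_forall fun u => ?_)
    simp
  refine ⟨hint, ?_⟩
  rw [limitMoment, ← integral_sub hint hint0]
  have h1 := norm_integral_le_of_norm_le hΨ' hbound
  rw [integral_uniform01 (fun u => Ψ (-Real.log u))] at h1
  simpa using h1

/-- Serves to absorb the additive constant in Y ≤ (γ + δ)x + δ = (γ + δ)(x + c): translate by c,
then enlarge the domain to (0, ∞). -/
lemma integrableOn_add_rpow_mul_exp_neg_mul {p c r : ℝ} (hp : 0 < p) (hc : 0 ≤ c) (hr : 0 < r) :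
    IntegrableOn (fun x : ℝ => (x + c) ^ (p - 1) * Real.exp (-(r * (x + c)))) (Ioi 0) ∧
      ∫ x in Ioi (0 : ℝ), (x + c) ^ (p - 1) * Real.exp (-(r * (x + c))) ≤
        (1 / r) ^ p * Real.Gamma p := by
  have hi := integrableOn_rpow_mul_exp_neg_mul (s := p - 1) (by linarith) hr
  have hsub : Ioi c ⊆ Ioi (0 : ℝ) := Ioi_subset_Ioi hc
  have hpre : (fun x : ℝ => x + c) ⁻¹' Ioi c = Ioi 0 := by ext; simp
  have hmp := measurePreserving_add_right (volume : Measure ℝ) c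
  have hme : MeasurableEmbedding (fun x : ℝ => x + c) := measurableEmbedding_addRight c
  constructor
  · have := (hmp.integrableOn_comp_preimage hme (s := Ioi c)
      (f := fun x : ℝ => x ^ (p - 1) * Real.exp (-(r * x)))).2 (hi.mono_set hsub)
    rwa [hpre] at this
  · have := hmp.setIntegral_preimage_emb hme
      (fun x : ℝ => x ^ (p - 1) * Real.exp (-(r * x))) (Ioi c)
    rw [hpre] at this
    rw [this, ← Real.integral_rpow_mul_exp_neg_mul_Ioi hp hr]
    refine setIntegral_mono_set hi ?_ hsub.eventuallyLE
    rw [EventuallyLE, ae_restrict_iff' measurableSet_Ioi]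
    refine Eventually.of_forall fun x hx => ?_
    exact mul_nonneg (Real.rpow_nonneg (le_of_lt hx) _) (Real.exp_pos _).le

end ExtremalNorm

/-! ### Moments of a perturbed exponential variable -/

namespace ExtremalNorm

/-- Moments of order at least one. -/
lemma moment_bound_of_one_le {γ δ D A p : ℝ} (hγ : 0 < γ) (hδ : 0 < δ) (hδ1 : δ < 1 / 2)
    (hp : 1 ≤ p) (hDA : 0 ≤ D * A) {y : ℝ → ℝ}
    (hym : AEStronglyMeasurable (fun u => y u ^ p) uniform01)
    (hy0 : ∀ x > 0, 0 ≤ y (Real.exp (-x)))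
    (hyd : ∀ x > 0, |y (Real.exp (-x)) - γ * x| ≤ D * A * Real.exp (2 * δ * x))
    (hyu : ∀ x > 0, y (Real.exp (-x)) ≤ (γ + δ) * x + δ) :
    Integrable (fun u => y u ^ p) uniform01 ∧
      |∫ u, y u ^ p ∂uniform01 - limitMoment γ p| ≤
        D * A * Real.exp (δ / (γ + δ)) / (γ + δ) * ((γ + δ) / (1 - 2 * δ)) ^ p *
          Real.Gamma (p + 1) := by
  set c : ℝ := δ / (γ + δ) with hc
  set r : ℝ := 1 - 2 * δ with hr
  have hr0 : 0 < r := by rw [hr]; linarith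
  have hr1 : r ≤ 1 := by rw [hr]; linarith
  have hs : 0 < γ + δ := by linarith
  have hc0 : 0 ≤ c := by positivity
  obtain ⟨hi, hI⟩ := integrableOn_add_rpow_mul_exp_neg_mul (p := p) (by linarith) hc0 hr0
  set k : ℝ := p * (γ + δ) ^ (p - 1) * (D * A) * Real.exp (r * c) with hk
  have hk0 : 0 ≤ k := by positivity
  set Ψ : ℝ → ℝ := fun x => p * ((γ + δ) * x + δ) ^ (p - 1) * (D * A * Real.exp (2 * δ * x))
    with hΨ
  have hΨeq : EqOn (fun x : ℝ => k * ((x + c) ^ (p - 1) * Real.exp (-(r * (x + c)))))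
      (fun x => Real.exp (-x) * Ψ x) (Ioi 0) := by
    intro x hx
    have hx0 : (0 : ℝ) < x := hx
    have h1 : (γ + δ) * x + δ = (γ + δ) * (x + c) := by rw [hc]; field_simp
    have h2 : Real.exp (r * c) * Real.exp (-(r * (x + c))) =
        Real.exp (-x) * Real.exp (2 * δ * x) := by
      rw [← Real.exp_add, ← Real.exp_add, hr]; ring_nf
    simp only [hΨ, hk, h1]
    rw [Real.mul_rpow hs.le (by positivity)]
    linear_combination (p * (γ + δ) ^ (p - 1) * (D * A) * (x + c) ^ (p - 1)) * h2
  have hΨi : IntegrableOn (fun x => Real.exp (-x) * Ψ x) (Ioi 0) := by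
    have h0 : IntegrableOn
      (fun x : ℝ => k * ((x + c) ^ (p - 1) * Real.exp (-(r * (x + c))))) (Ioi 0) := hi.const_mul _
    exact h0.congr_fun hΨeq measurableSet_Ioi
  obtain ⟨h1, h2⟩ := integrable_and_abs_sub_limitMoment_le hγ.le (by linarith) hym hΨi
    (fun x hx => by
      refine (abs_rpow_sub_rpow_le_of_one_le hp (hy0 x hx) (by positivity) (hyu x hx)
        (by nlinarith)).trans ?_
      refine mul_le_mul_of_nonneg_left (hyd x hx) ?_
      have : 0 ≤ (γ + δ) * x + δ := by positivity
      positivity)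
  refine ⟨h1, h2.trans ?_⟩
  rw [← setIntegral_congr_fun measurableSet_Ioi hΨeq, integral_const_mul]
  have hG : Real.Gamma (p + 1) = p * Real.Gamma p := Real.Gamma_add_one (by linarith)
  have hΓ : 0 < Real.Gamma p := Real.Gamma_pos_of_pos (by linarith)
  calc k * _ ≤ k * ((1 / r) ^ p * Real.Gamma p) := mul_le_mul_of_nonneg_left hI hk0
    _ = D * A * Real.exp (r * c) / (γ + δ) * ((γ + δ) / r) ^ p * Real.Gamma (p + 1) := by
      rw [hk, hG, Real.rpow_sub_one hs.ne', Real.div_rpow hs.le hr0.le,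
        Real.div_rpow zero_le_one hr0.le, Real.one_rpow]
      field_simp
    _ ≤ _ := by
      have h3 : r * c ≤ c := by nlinarith
      rw [hG]
      gcongr

/-- Moments of order at most one. -/
lemma moment_bound_of_le_one {γ δ D A p : ℝ} (hγ : 0 < γ) (hδ : 0 < δ) (hδ1 : δ < 1 / 2)
    (hp0 : 0 < p) (hp : p ≤ 1) (hDA : 0 ≤ D * A) {y : ℝ → ℝ}
    (hym : AEStronglyMeasurable (fun u => y u ^ p) uniform01)
    (hy0 : ∀ x > 0, 0 ≤ y (Real.exp (-x)))
    (hyd : ∀ x > 0, |y (Real.exp (-x)) - γ * x| ≤ D * A * Real.exp (2 * δ * x)) :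
    Integrable (fun u => y u ^ p) uniform01 ∧
      |∫ u, y u ^ p ∂uniform01 - limitMoment γ p| ≤
        2 * (D * A) / γ * (γ / (1 - 2 * δ)) ^ p * Real.Gamma (p + 1) +
          2 * Real.exp (2 * δ) / γ * (D * A) *
            (1 + γ + ∫ x in Ioi (0 : ℝ), (1 + γ * x) * Real.exp (-((1 - 2 * δ) * x))) := by
  set r : ℝ := 1 - 2 * δ with hr
  have hr0 : 0 < r := by rw [hr]; linarith
  set E : ℝ := D * A with hE
  set κ : ℝ := 2 * Real.exp (2 * δ) / γ * E with hκ
  have hκ0 : 0 ≤ κ := by positivity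
  set Φ₁ : ℝ → ℝ := fun x => 2 * p * E * γ ^ (p - 1) * (x ^ (p - 1) * Real.exp (-(r * x)))
  set Φ₂ : ℝ → ℝ := (Ioc 0 κ).indicator fun x => (1 + γ) * Real.exp (-x)
  set Φ₃ : ℝ → ℝ := fun x => κ * ((1 + γ * x) * Real.exp (-(r * x)))
  set Ψ : ℝ → ℝ := fun x => 2 * p * E * γ ^ (p - 1) * (x ^ (p - 1) * Real.exp (2 * δ * x)) +
    (Ioc 0 κ).indicator (fun _ => 1 + γ) x + κ * ((1 + γ * x) * Real.exp (2 * δ * x)) with hΨ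
  have hexp : ∀ x : ℝ, Real.exp (-(r * x)) = Real.exp (-x) * Real.exp (2 * δ * x) := fun x => by
    rw [← Real.exp_add, hr]; ring_nf
  have hΨeq : ∀ x, Real.exp (-x) * Ψ x = Φ₁ x + Φ₂ x + Φ₃ x := fun x => by
    simp only [hΨ, Φ₁, Φ₂, Φ₃, hexp, indicator]
    split_ifs <;> ring
  have hi₁ : IntegrableOn Φ₁ (Ioi 0) :=
    (integrableOn_rpow_mul_exp_neg_mul (s := p - 1) (by linarith) hr0).const_mul _
  have hi₂' : IntegrableOn (fun x => (1 + γ) * Real.exp (-x)) (Ioc 0 κ) :=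
    Continuous.integrableOn_Ioc (by fun_prop)
  have hi₂ : IntegrableOn Φ₂ (Ioi 0) :=
    ((integrable_indicator_iff measurableSet_Ioc).2 hi₂').integrableOn
  have hi₃ : IntegrableOn Φ₃ (Ioi 0) := by
    have h0 := (integrableOn_rpow_mul_exp_neg_mul (s := 0) (by norm_num) hr0).add
      ((integrableOn_rpow_mul_exp_neg_mul (s := 1) (by norm_num) hr0).const_mul γ)
    refine Integrable.const_mul (h0.congr (Eventually.of_forall fun x => ?_)) κ
    simp only [Pi.add_apply, Real.rpow_zero, Real.rpow_one]
    ring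
  have hi₁₂ : IntegrableOn (fun x => Φ₁ x + Φ₂ x) (Ioi 0) := hi₁.add hi₂
  have hΨi : IntegrableOn (fun x => Real.exp (-x) * Ψ x) (Ioi 0) := by
    simp only [hΨeq]
    exact hi₁₂.add hi₃
  have hle : ∀ x > 0, |y (Real.exp (-x)) ^ p - (γ * x) ^ p| ≤ Ψ x := by
    intro x hx
    have hb : 0 < γ * x := by positivity
    refine (abs_rpow_sub_rpow_le_of_le_one hp0 hp (hy0 x hx) hb).trans ?_
    rw [hΨ]
    simp only [add_assoc]
    have hind : 0 ≤ (Ioc 0 κ).indicator (fun _ => 1 + γ) x :=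
      indicator_nonneg (fun _ _ => by positivity) _
    refine add_le_add ?_ ?_
    · rw [Real.mul_rpow hγ.le hx.le]
      calc 2 * p * |y (Real.exp (-x)) - γ * x| * (γ ^ (p - 1) * x ^ (p - 1))
          ≤ 2 * p * (E * Real.exp (2 * δ * x)) * (γ ^ (p - 1) * x ^ (p - 1)) := by
            have := hyd x hx
            gcongr
        _ = _ := by ring
    -- The condition γx ≤ 2E exp(2δx) forces either x ≤ κ, on an interval of length O(A), or x > 1
    -- and κ exp(2δx) ≥ 1. In both cases (γx)^p ≤ 1 + γx.
    · split_ifs with h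
      · have h1 : γ * x ≤ 2 * (E * Real.exp (2 * δ * x)) :=
          h.trans (mul_le_mul_of_nonneg_left (hyd x hx) zero_le_two)
        have h2 : (γ * x) ^ p ≤ 1 + γ * x := by
          have := rpow_one_add_le_one_add_mul_self (s := γ * x) (by linarith) hp0.le hp
          have h3 : (γ * x) ^ p ≤ (1 + γ * x) ^ p :=
            Real.rpow_le_rpow hb.le (by linarith) hp0.le
          nlinarith
        have h3 : x ≤ 2 / γ * E * Real.exp (2 * δ * x) := by
          have : 2 / γ * E * Real.exp (2 * δ * x) = 2 * (E * Real.exp (2 * δ * x)) / γ := by ring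
          rw [this, le_div_iff₀ hγ]
          linarith
        rcases le_or_gt x 1 with hx1 | hx1
        · have h4 : x ≤ κ := by
            refine h3.trans ?_
            rw [hκ]
            have : Real.exp (2 * δ * x) ≤ Real.exp (2 * δ) := Real.exp_le_exp.2 (by nlinarith)
            calc 2 / γ * E * Real.exp (2 * δ * x) ≤ 2 / γ * E * Real.exp (2 * δ) := by gcongr
              _ = _ := by ring
          rw [indicator_of_mem (show x ∈ Ioc 0 κ from ⟨hx, h4⟩)]
          have : 0 ≤ κ * ((1 + γ * x) * Real.exp (2 * δ * x)) := by positivity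
          nlinarith
        · have h4 : 1 ≤ κ * Real.exp (2 * δ * x) := by
            refine hx1.le.trans (h3.trans ?_)
            have : 2 / γ * E ≤ κ := by
              have h5 : 1 ≤ Real.exp (2 * δ) := Real.one_le_exp (by positivity)
              calc 2 / γ * E = 2 * 1 / γ * E := by ring
                _ ≤ κ := by rw [hκ]; gcongr
            gcongr
          have : (1 + γ * x) * 1 ≤ (1 + γ * x) * (κ * Real.exp (2 * δ * x)) := by gcongr
          linarith
      · positivity
  obtain ⟨h1, h2⟩ := integrable_and_abs_sub_limitMoment_le hγ.le hp0 hym hΨi hle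
  refine ⟨h1, h2.trans ?_⟩
  have hsplit : ∫ x in Ioi (0 : ℝ), Real.exp (-x) * Ψ x =
      (∫ x in Ioi (0 : ℝ), Φ₁ x) + (∫ x in Ioi (0 : ℝ), Φ₂ x) + ∫ x in Ioi (0 : ℝ), Φ₃ x := by
    simp only [hΨeq]
    rw [integral_add hi₁₂ hi₃, integral_add hi₁ hi₂]
  have hI₁ : ∫ x in Ioi (0 : ℝ), Φ₁ x = 2 * E / γ * (γ / r) ^ p * Real.Gamma (p + 1) := by
    rw [integral_const_mul, Real.integral_rpow_mul_exp_neg_mul_Ioi hp0 hr0,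
      Real.Gamma_add_one hp0.ne', Real.rpow_sub_one hγ.ne', Real.div_rpow hγ.le hr0.le,
      Real.div_rpow zero_le_one hr0.le, Real.one_rpow]
    field_simp
  have hI₂ : ∫ x in Ioi (0 : ℝ), Φ₂ x ≤ κ * (1 + γ) := by
    have h3 : Ioi 0 ∩ Ioc 0 κ = Ioc 0 κ := inter_eq_right.2 Ioc_subset_Ioi_self
    rw [setIntegral_indicator measurableSet_Ioc, h3]
    have h4 : ∫ x in Ioc 0 κ, (1 + γ) * Real.exp (-x) ≤ ∫ x in Ioc 0 κ, (1 + γ) := by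
      refine setIntegral_mono_on hi₂' (integrableOn_const (by simp)) measurableSet_Ioc
        fun x hx => ?_
      have : Real.exp (-x) ≤ 1 := Real.exp_le_one_iff.2 (by linarith [hx.1])
      nlinarith
    refine h4.trans_eq ?_
    simp [hκ0]
  have hI₃ : ∫ x in Ioi (0 : ℝ), Φ₃ x =
      κ * ∫ x in Ioi (0 : ℝ), (1 + γ * x) * Real.exp (-(r * x)) := integral_const_mul _ _
  rw [hsplit, hI₁, hI₃]
  linarith

/-- Comparison of all moments of a perturbation of an exponential variable of size `O(A)`. -/
lemma exists_moment_bound {γ ε δ D : ℝ} (hγ : 0 < γ) (hε : 0 < ε) (hδ : 0 < δ) (hδ1 : δ < 1 / 2)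
    (hδε : γ + δ ≤ (γ + ε) * (1 - 2 * δ)) (hD : 0 < D) :
    ∃ K : ℝ, 0 < K ∧ ∀ A p : ℝ, 0 < A → 0 < p → ∀ y : ℝ → ℝ,
      AEStronglyMeasurable (fun u => y u ^ p) uniform01 →
      (∀ x > 0, 0 ≤ y (Real.exp (-x))) →
      (∀ x > 0, |y (Real.exp (-x)) - γ * x| ≤ D * A * Real.exp (2 * δ * x)) →
      (∀ x > 0, y (Real.exp (-x)) ≤ (γ + δ) * x + δ) →
      Integrable (fun u => y u ^ p) uniform01 ∧
        |∫ u, y u ^ p ∂uniform01 - limitMoment γ p| ≤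
          K * A * (γ + ε) ^ p * Real.Gamma (p + 1) := by
  have hr0 : 0 < 1 - 2 * δ := by linarith
  have hγε : 0 < γ + ε := by linarith
  have hbase : (γ + δ) / (1 - 2 * δ) ≤ γ + ε := (div_le_iff₀ hr0).2 hδε
  have hbase' : γ / (1 - 2 * δ) ≤ γ + ε := le_trans (by gcongr; linarith) hbase
  -- The bound for p ≤ 1 has a term K₂ A without the factor (γ + ε)^p Γ(p + 1); the positive minimum
  -- of that factor over [0, 1] absorbs it.
  obtain ⟨q, hq, hqmin⟩ := (isCompact_Icc (a := (0 : ℝ)) (b := 1)).exists_isMinOn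
    (f := fun p => (γ + ε) ^ p * Real.Gamma (p + 1)) ⟨0, by simp⟩ (by
      refine ContinuousOn.mul (Continuous.continuousOn (by fun_prop (disch := positivity))) ?_
      intro p hp
      have h1 : DifferentiableAt ℝ Real.Gamma (p + 1) := Real.differentiableAt_Gamma fun m => by
        have : (0 : ℝ) ≤ m := m.cast_nonneg
        linarith [hp.1]
      exact (h1.continuousAt.comp (f := fun p : ℝ => p + 1) (by fun_prop)).continuousWithinAt)
  set c : ℝ := (γ + ε) ^ q * Real.Gamma (q + 1) with hc
  have hc0 : 0 < c :=
    mul_pos (Real.rpow_pos_of_pos hγε _) (Real.Gamma_pos_of_pos (by linarith [hq.1]))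
  set I : ℝ := ∫ x in Ioi (0 : ℝ), (1 + γ * x) * Real.exp (-((1 - 2 * δ) * x))
  have hI : 0 ≤ I := setIntegral_nonneg measurableSet_Ioi fun x hx => by
    have : (0 : ℝ) < x := hx
    positivity
  set K₁ : ℝ := D * Real.exp (δ / (γ + δ)) / (γ + δ)
  set K₂ : ℝ := 2 * Real.exp (2 * δ) / γ * D * (1 + γ + I) with hK₂
  refine ⟨K₁ + 2 * D / γ + K₂ / c, by positivity, fun A p hA hp y hym hy0 hyd hyu => ?_⟩
  have hΓ : 0 < Real.Gamma (p + 1) := Real.Gamma_pos_of_pos (by linarith)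
  have hK₁0 : 0 ≤ K₁ := by positivity
  have hK₂0 : 0 ≤ K₂ := by positivity
  have hG : 0 < (γ + ε) ^ p * Real.Gamma (p + 1) := mul_pos (Real.rpow_pos_of_pos hγε _) hΓ
  set G : ℝ := (γ + ε) ^ p * Real.Gamma (p + 1) with hGdef
  rcases le_total 1 p with hp1 | hp1
  · obtain ⟨h1, h2⟩ := moment_bound_of_one_le hγ hδ hδ1 hp1 (by positivity) hym hy0 hyd hyu
    refine ⟨h1, h2.trans ?_⟩
    calc _ ≤ D * A * Real.exp (δ / (γ + δ)) / (γ + δ) * (γ + ε) ^ p * Real.Gamma (p + 1) := by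
          gcongr
      _ = K₁ * (A * G) := by ring
      _ ≤ (K₁ + 2 * D / γ + K₂ / c) * (A * G) := by
          refine mul_le_mul_of_nonneg_right ?_ (by positivity)
          have : 0 ≤ 2 * D / γ + K₂ / c := by positivity
          linarith
      _ = _ := by ring
  · obtain ⟨h1, h2⟩ := moment_bound_of_le_one hγ hδ hδ1 hp hp1 (by positivity) hym hy0 hyd
    refine ⟨h1, h2.trans ?_⟩
    have hcG : c ≤ G := hqmin (a := p) ⟨hp.le, hp1⟩
    have h3 : K₂ * A ≤ K₂ / c * (A * G) := by
      have h4 : 1 ≤ G / c := (one_le_div hc0).2 hcG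
      calc K₂ * A = K₂ * A * 1 := by ring
        _ ≤ K₂ * A * (G / c) := by gcongr
        _ = _ := by ring
    have h5 : 2 * (D * A) / γ * (γ / (1 - 2 * δ)) ^ p * Real.Gamma (p + 1) ≤
        2 * D / γ * (A * G) := by
      calc _ ≤ 2 * (D * A) / γ * (γ + ε) ^ p * Real.Gamma (p + 1) := by gcongr
        _ = _ := by rw [hGdef]; ring
    have h6 : 0 ≤ K₁ * (A * G) := by positivity
    have h7 : (K₁ + 2 * D / γ + K₂ / c) * A * (γ + ε) ^ p * Real.Gamma (p + 1) =
        K₁ * (A * G) + 2 * D / γ * (A * G) + K₂ / c * (A * G) := by rw [hGdef]; ring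
    have h8 : 2 * Real.exp (2 * δ) / γ * (D * A) * (1 + γ + I) = K₂ * A := by rw [hK₂]; ring
    rw [h7, h8]
    linarith

end ExtremalNorm

namespace ExtremalNorm

/-! ### Quantiles -/

/-- For levels strictly between 0 and 1 the sets are nonempty and bounded below, so `sInf` is a
genuine infimum. -/
lemma quantile_monotoneOn (μ : Measure ℝ) [IsProbabilityMeasure μ] :
    MonotoneOn (quantile μ) (Ioo 0 1) := by
  intro s hs t ht hst
  refine csInf_le_csInf ?_ ?_ fun x (hx : t ≤ cdf μ x) => hst.trans hx
  · obtain ⟨b, hb⟩ := ((tendsto_cdf_atBot μ).eventually_lt_const hs.1).exists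
    refine ⟨b, fun x (hx : s ≤ cdf μ x) => ?_⟩
    by_contra! hxb
    exact absurd (hx.trans (monotone_cdf μ hxb.le)) (not_le.2 hb)
  · obtain ⟨b, hb⟩ := ((tendsto_cdf_atTop μ).eventually_const_lt ht.2).exists
    exact ⟨b, hb.le⟩

lemma aestronglyMeasurable_Y_rpow (μ : Measure ℝ) [IsProbabilityMeasure μ] {v : ℝ}
    (hv : v ∈ Ioo (0 : ℝ) 1) (p : ℝ) :
    AEStronglyMeasurable (fun u => Y μ v u ^ p) uniform01 := by
  have hanti : AntitoneOn (fun u => quantile μ (1 - u * v)) (Ioo 0 1) := by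
    intro s hs t ht hst
    refine quantile_monotoneOn μ ⟨?_, ?_⟩ ⟨?_, ?_⟩ ?_
    · nlinarith [ht.1, ht.2, hv.1, hv.2]
    · nlinarith [mul_pos ht.1 hv.1]
    · nlinarith [hs.1, hs.2, hv.1, hv.2]
    · nlinarith [mul_pos hs.1 hv.1]
    · nlinarith [hv.1]
  have h1 : AEMeasurable (fun u => quantile μ (1 - u * v)) uniform01 :=
    aemeasurable_restrict_of_antitoneOn measurableSet_Ioo hanti
  exact ((Real.measurable_log.comp_aemeasurable (h1.div_const _)).pow_const p).aestronglyMeasurable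

/-- The logarithm of a ratio of quantiles, given a bound on the increments of the slowly varying
factor. -/
lemma Y_exp_neg_bounds {μ : Measure ℝ} [IsProbabilityMeasure μ] {γ : ℝ} (hγ : 0 < γ)
    {l : ℝ → ℝ} (hQ : ∀ s ∈ Ioo (0 : ℝ) 1, quantile μ (1 - s) = s ^ (-γ) * l s) {v : ℝ}
    (hv : v ∈ Ioo (0 : ℝ) 1) (hlv : 0 < l v) {A C δ : ℝ} (hδ : 0 < δ) (hCA : C * A ≤ δ)
    (hCA0 : 0 ≤ C * A) {x : ℝ} (hx : 0 < x)
    (hlx : |l (Real.exp (-x) * v) - l v| ≤ C * A * l v * Real.exp (δ * x)) :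
    0 ≤ Y μ v (Real.exp (-x)) ∧
      |Y μ v (Real.exp (-x)) - γ * x| ≤ 2 * C * (1 + γ / δ) * A * Real.exp (2 * δ * x) ∧
      Y μ v (Real.exp (-x)) ≤ (γ + δ) * x + δ := by
  have hu0 : 0 < Real.exp (-x) := Real.exp_pos _
  have hu1 : Real.exp (-x) < 1 := by simpa using hx
  set u := Real.exp (-x) with hu
  have huv : u * v ∈ Ioo (0 : ℝ) 1 := ⟨mul_pos hu0 hv.1, by nlinarith [hv.1, hv.2]⟩
  have hQv : 0 < quantile μ (1 - v) := by
    rw [hQ v hv]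
    exact mul_pos (Real.rpow_pos_of_pos hv.1 _) hlv
  have hQle : quantile μ (1 - v) ≤ quantile μ (1 - u * v) :=
    quantile_monotoneOn μ ⟨by linarith [hv.2], by linarith [hv.1]⟩
      ⟨by linarith [huv.2], by linarith [huv.1]⟩ (by nlinarith [hv.1])
  -- Positivity at uv comes from monotonicity of Q.
  have hluv : 0 < l (u * v) := by
    have h1 : 0 < quantile μ (1 - u * v) := hQv.trans_le hQle
    rw [hQ _ huv] at h1
    exact (mul_pos_iff_of_pos_left (Real.rpow_pos_of_pos huv.1 _)).1 h1
  set w := l (u * v) / l v with hw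
  have hw0 : 0 < w := div_pos hluv hlv
  have hY0 : 0 ≤ Y μ v u := Real.log_nonneg ((one_le_div hQv).2 hQle)
  have hYw : Y μ v u = γ * x + Real.log w := by
    have h1 : quantile μ (1 - u * v) / quantile μ (1 - v) = u ^ (-γ) * w := by
      rw [hQ v hv, hQ _ huv, Real.mul_rpow hu0.le hv.1.le, hw]
      have := (Real.rpow_pos_of_pos hv.1 (-γ)).ne'
      field_simp
    rw [Y, h1, Real.log_mul (Real.rpow_pos_of_pos hu0 _).ne' hw0.ne', Real.log_rpow hu0, hu,
      Real.log_exp]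
    ring
  set E := C * A * Real.exp (δ * x) with hE
  have hE0 : 0 ≤ E := by positivity
  have hwE : |w - 1| ≤ E := by
    have h1 : w - 1 = (l (u * v) - l v) / l v := by rw [hw]; field_simp
    rw [h1, abs_div, abs_of_pos hlv, div_le_iff₀ hlv]
    linarith
  obtain ⟨hwl, hwu⟩ := abs_le.1 hwE
  have hlogu : Real.log w ≤ E := (Real.log_le_sub_one_of_pos hw0).trans hwu
  have hexp1 : 1 ≤ Real.exp (δ * x) := Real.one_le_exp (by positivity)
  refine ⟨hY0, ?_, ?_⟩
  -- For E ≤ 1/2, log w ≥ 1 - 1/w ≥ -2E. Otherwise 2E > 1, and Y ≥ 0 already gives log w ≥ -γx.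
  · have hlogl : -(2 * E * (1 + γ * x)) ≤ Real.log w := by
      have hγx : 0 ≤ γ * x := by positivity
      rcases le_or_gt E (1 / 2) with h | h
      · have h1 := Real.one_sub_inv_le_log_of_pos hw0
        have h2 : w⁻¹ ≤ 1 + 2 * E := by
          rw [inv_le_iff_one_le_mul₀ hw0]
          nlinarith
        nlinarith
      · nlinarith
    have hEx : 0 ≤ E * (γ * x) := by positivity
    have h1 : |Real.log w| ≤ 2 * E * (1 + γ * x) := abs_le.2 ⟨hlogl, by linarith⟩
    have h2 : 1 + γ * x ≤ (1 + γ / δ) * Real.exp (δ * x) := by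
      have h3 := Real.add_one_le_exp (δ * x)
      have h4 : γ * x = γ / δ * (δ * x) := by field_simp
      have h5 : γ / δ * (δ * x) ≤ γ / δ * Real.exp (δ * x) := by gcongr; linarith
      linarith
    have h3 : Real.exp (2 * δ * x) = Real.exp (δ * x) * Real.exp (δ * x) := by
      rw [← Real.exp_add]; ring_nf
    rw [hYw, add_sub_cancel_left]
    calc |Real.log w| ≤ 2 * E * (1 + γ * x) := h1
      _ ≤ 2 * E * ((1 + γ / δ) * Real.exp (δ * x)) := by gcongr
      _ = _ := by rw [h3, hE]; ring
  -- w ≤ 1 + E ≤ (1 + δ) exp(δx), using C A ≤ δ.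
  · have h1 : w ≤ Real.exp (δ + δ * x) := by
      rw [Real.exp_add]
      have h2 := Real.add_one_le_exp δ
      have h3 : E ≤ δ * Real.exp (δ * x) := by rw [hE]; gcongr
      nlinarith
    have h2 := Real.log_le_log hw0 h1
    rw [Real.log_exp] at h2
    rw [hYw]
    linarith

/-- The moments of `Y` converge at the rate `a / l`, uniformly in the order of the moment up to an
exponential factor. -/
theorem exists_moment_sub_limitMoment_bound (μ : Measure ℝ) [IsProbabilityMeasure μ]
    {γ : ℝ} (hγ : 0 < γ) {l : ℝ → ℝ} (hl : SlowlyVaryingAtZero l)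
    (hQ : ∀ s ∈ Ioo (0 : ℝ) 1, quantile μ (1 - s) = s ^ (-γ) * l s)
    {a : ℝ → ℝ} {ρ : ℝ} (ha : RegularlyVaryingAtZero a ρ)
    (hal : Tendsto (fun v : ℝ => a v / l v) (𝓝[>] (0 : ℝ)) (𝓝 0))
    {B : Set ℝ} (hB : MeasurableSet B) (hB0 : B ⊆ Ici 0) (hBpos : 0 < volume B)
    (hlB : ∀ u ∈ B,
      limsup (fun v : ℝ => ((|l (u * v) - l v| / a v : ℝ) : EReal)) (𝓝[>] (0 : ℝ)) < ⊤)
    {ε : ℝ} (hε : 0 < ε) :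
    ∃ K : ℝ, 0 < K ∧ ∀ᶠ v in 𝓝[>] (0 : ℝ), ∀ p : ℝ, 0 < p →
      Integrable (fun u : ℝ => Y μ v u ^ p) uniform01 ∧
      |moment μ p v - limitMoment γ p| ≤ K * (a v / l v) * (γ + ε) ^ p * Real.Gamma (p + 1) := by
  -- Small enough that (γ + δ)/(1 - 2δ) ≤ γ + ε, i.e. δ(1 + 2γ + 2ε) ≤ ε.
  set δ : ℝ := ε / (4 * (1 + γ + ε)) with hδdef
  have hδ : 0 < δ := by positivity
  have hδeq : δ * (4 * (1 + γ + ε)) = ε := by rw [hδdef]; field_simp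
  have hδ1 : δ < 1 / 2 := by nlinarith
  obtain ⟨C, hC, hCv⟩ := exists_abs_sub_le_mul_rpow ha hl hal hB hB0 hBpos hlB hδ
  obtain ⟨K, hK, hKb⟩ := exists_moment_bound (D := 2 * C * (1 + γ / δ)) hγ hε hδ hδ1
    (by nlinarith) (by positivity)
  refine ⟨K, hK, ?_⟩
  have hsmall : ∀ᶠ v in 𝓝[>] (0 : ℝ), C * (a v / l v) < δ := by
    have h1 := hal.const_mul C
    rw [mul_zero] at h1
    exact h1.eventually_lt_const hδ
  filter_upwards [hCv, hsmall, ha.eventually_pos, RegularlyVaryingAtZero.eventually_pos hl,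
    Ioo_mem_nhdsGT one_pos] with v hv hCA hav hlv hv01 p hp
  have hA : 0 < a v / l v := div_pos hav hlv
  have hY := fun x (hx : x > 0) => Y_exp_neg_bounds (μ := μ) hγ hQ hv01 hlv (A := a v / l v) hδ
    hCA.le (by positivity) hx (by
      have h1 : C * (a v / l v) * l v = C * a v := by field_simp
      rw [h1]
      exact hv x hx.le)
  exact hKb (a v / l v) p hA hp (Y μ v) (aestronglyMeasurable_Y_rpow μ hv01 p)
    (fun x hx => (hY x hx).1) (fun x hx => (hY x hx).2.1) (fun x hx => (hY x hx).2.2)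

end ExtremalNorm

theorem mainTheorem6
    (μ : Measure ℝ) [IsProbabilityMeasure μ]
    (γ : ℝ) (hγ : 0 < γ)
    (l : ℝ → ℝ) (hl : ExtremalNorm.SlowlyVaryingAtZero l)
    (hQ : ∀ s ∈ Ioo (0 : ℝ) 1, ExtremalNorm.quantile μ (1 - s) = s ^ (-γ) * l s)
    (a : ℝ → ℝ) (ρ : ℝ) (ha : ExtremalNorm.RegularlyVaryingAtZero a ρ)
    (hal : Tendsto (fun v : ℝ => a v / l v) (𝓝[>] (0 : ℝ)) (𝓝 0))
    (B : Set ℝ) (hB : MeasurableSet B) (hB01 : B ⊆ Icc (0 : ℝ) 1) (hBpos : 0 < volume B)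
    (hlB : ∀ u ∈ B,
      limsup (fun v : ℝ => ((|l (u * v) - l v| / a v : ℝ) : EReal)) (𝓝[>] (0 : ℝ)) < ⊤)
    (p : ℝ → ℝ) (hp : ∀ᶠ v in 𝓝[>] (0 : ℝ), 0 < p v)
    (β : EReal)
    (hβ : β = liminf (fun v : ℝ => ((-Real.log (a v / l v) / p v : ℝ) : EReal)) (𝓝[>] (0 : ℝ)))
    (hβpos : 0 < β) :
    (∀ᶠ v in 𝓝[>] (0 : ℝ),
      Integrable (fun u : ℝ => ExtremalNorm.Y μ v u ^ p v) ExtremalNorm.uniform01) ∧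
    (1 < ExtremalNorm.nu β → ∀ ε : ℝ, 0 < ε → ∃ K : ℝ, 0 < K ∧ ∀ᶠ v in 𝓝[>] (0 : ℝ),
      |ExtremalNorm.moment μ (p v) v - ExtremalNorm.limitMoment γ (p v)| ≤
        K * (a v / l v) * (γ + ε) ^ p v * Real.Gamma (p v + 1)) ∧
    (ExtremalNorm.nu β ≤ 1 → ∀ ε : ℝ, 0 < ε → ∃ K : ℝ, 0 < K ∧ ∀ᶠ v in 𝓝[>] (0 : ℝ),
      |ExtremalNorm.moment μ (p v) v - ExtremalNorm.limitMoment γ (p v)| ≤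
        K * (a v / l v) ^ (ExtremalNorm.nu β - ε) * (γ + ε) ^ p v * Real.Gamma (p v + 1)) := by
  have key := fun (ε : ℝ) (hε : 0 < ε) =>
    ExtremalNorm.exists_moment_sub_limitMoment_bound μ hγ hl hQ ha hal hB
      (fun u hu => (hB01 hu).1) hBpos hlB hε
  refine ⟨?_, fun _ ε hε => ?_, fun hν ε hε => ?_⟩
  · obtain ⟨K, -, hK⟩ := key 1 one_pos
    filter_upwards [hK, hp] with v hv hpv using (hv (p v) hpv).1
  · obtain ⟨K, hK0, hK⟩ := key ε hε
    refine ⟨K, hK0, ?_⟩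
    filter_upwards [hK, hp] with v hv hpv using (hv (p v) hpv).2
  · obtain ⟨K, hK0, hK⟩ := key ε hε
    refine ⟨K, hK0, ?_⟩
    filter_upwards [hK, hp, ha.eventually_pos,
      ExtremalNorm.RegularlyVaryingAtZero.eventually_pos hl,
      hal.eventually_lt_const one_pos] with v hv hpv hav hlv hA1
    refine (hv (p v) hpv).2.trans ?_
    have hA : 0 < a v / l v := div_pos hav hlv
    -- For a base in (0, 1), lowering the exponent from 1 to ν - ε increases the power.
    have h1 : a v / l v ≤ (a v / l v) ^ (ExtremalNorm.nu β - ε) := by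
      conv_lhs => rw [← Real.rpow_one (a v / l v)]
      exact Real.rpow_le_rpow_of_exponent_ge hA hA1.le (by linarith)
    have h2 : 0 < Real.Gamma (p v + 1) := Real.Gamma_pos_of_pos (by linarith)
    gcongr
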